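/- Call $V:\mathbb C\to[0,\infty)$ a *potential* if it is continuous, satisfies $V(\bar z)=V(z)$ for all $z$, and there is $\delta>0$ such that $V(z)\ge(1+\delta)\log(|z|^2+1)$ for all $z$ with $|z|$ large enough. Call it *quadratic* if $V(z)=a_1z^2+a_2\bar z^2+a_3z\bar z$ for some $a_1,a_2,a_3\in\mathbb C$. For $z=(z_1,\dots,z_n)\in\mathbb C^n$ put $z_{n+i}:=\bar z_i$ $(1\le i\le n)$, let $$K_n(z)=\sum_{1\le i\ne j\le 2n}\Big(\log|z_i-z_j|^{-1}+\tfrac12\big(V(z_i)+V(z_j)\big)\Big),$$ and let $P_n^V$ be the probability measure on $\mathbb C^n$ whose density with respect to Lebesgue measure is $$\frac1{c_n^V}\exp\Big(-\tfrac12\Big(K_n(z)+\sum_{i=1}^{2n}V(z_i)+\sum_{i=1}^{2n}\log|z_i-\bar z_i|^{-1}\Big)\Big),$$ with $c_n^V$ the normalization constant. Let $\mathbb S(\mathbb H)$ be the unit sphere of the quaternions $\mathbb H\supset\mathbb C$, with its uniform probability measure. **Theorem.** There is no quadratic potential $V$ with the following property: for some random vectors $(z_{n,1},\dots,z_{n,n})$,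 $n\ge1$, on a common probability space, the $n$-th one distributed according to $P_n^V$, with $z_{n,n+i}:=\overline{z_{n,i}}$, and some independent random variables $u_1,u_2,\dots$ on the same space, uniformly distributed on $\mathbb S(\mathbb H)$ and such that for each $n$ the sequence $(u_i)_{i\ge1}$ is independent of $(z_{n,1},\dots,z_{n,n})$, the random measure $$\frac1{2n}\sum_{i=1}^{2n}\delta_{u_iz_{n,i}u_i^*}$$ converges weakly to the uniform measure on $\mathbb S(\mathbb H)$ as $n\to\infty$, almost surely or in probability. -/

import Mathlib

open MeasureTheory ProbabilityTheory Filter Topology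
open scoped Quaternion ComplexConjugate BoundedContinuousFunction

/-- The quaternions carry their Borel sigma-algebra. -/
noncomputable instance quaternionMeasurableSpace : MeasurableSpace ℍ[ℝ] := borel ℍ[ℝ]

instance quaternionBorelSpace : BorelSpace ℍ[ℝ] := ⟨rfl⟩

noncomputable section

namespace QuatGas

/-- Admissible (finite-valued) potentials: continuous, non-negative, invariant under complex
conjugation, and growing faster than `(1 + δ) log (|z|² + 1)` at infinity for some `δ > 0`.
(The set where `V` is finite is all of `ℂ`, hence has positive capacity.) -/
structure IsPotential (V : ℂ → ℝ) : Prop where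
  continuous : Continuous V
  nonneg : ∀ z, 0 ≤ V z
  conj_invariant : ∀ z, V (conj z) = V z
  growth : ∃ δ : ℝ, 0 < δ ∧ ∃ R : ℝ, ∀ z : ℂ, R ≤ ‖z‖ →
    (δ + 1) * Real.log (‖z‖ ^ 2 + 1) ≤ V z

/-- `V(z) = a₁ z² + a₂ z̄² + a₃ z z̄` with complex coefficients. -/
def IsQuadratic (V : ℂ → ℝ) : Prop :=
  ∃ a₁ a₂ a₃ : ℂ, ∀ z : ℂ,
    (V z : ℂ) = a₁ * z ^ 2 + a₂ * (conj z) ^ 2 + a₃ * (z * conj z)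

/-- The points `z₁, …, z_n` followed by their conjugates: `z_{n+i} = conj z_i`. -/
def withConj {n : ℕ} (z : Fin n → ℂ) : Fin (n + n) → ℂ :=
  Fin.append z (fun i => conj (z i))

/-- `k(x, y) = log |x - y|⁻¹ + (V(x) + V(y)) / 2`. -/
def kernelFn (V : ℂ → ℝ) (x y : ℂ) : ℝ :=
  Real.log (‖x - y‖⁻¹) + (1 / 2) * (V x + V y)

/-- `K_n(z)`: the sum of `k(z_i, z_j)` over ordered pairs `i ≠ j` among the `2n` points. -/
def energySum (V : ℂ → ℝ) (n : ℕ) (z : Fin n → ℂ) : ℝ :=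
  ∑ i : Fin (n + n), ∑ j : Fin (n + n),
    if i ≠ j then kernelFn V (withConj z i) (withConj z j) else 0

/-- The unnormalized density `exp (-(1/2) (K_n(z) + ∑ V(z_i) + ∑ log |z_i - conj z_i|⁻¹))`, the
sums running over the `2n` points. (Configurations with coinciding points are Lebesgue-null, so
the value of `Real.log 0` plays no role for the law below.) -/
def weight (V : ℂ → ℝ) (n : ℕ) (z : Fin n → ℂ) : ℝ :=
  Real.exp (-(1 / 2) *
    (energySum V n z + ∑ i : Fin (n + n), V (withConj z i)
      + ∑ i : Fin (n + n), Real.log (‖withConj z i - conj (withConj z i)‖⁻¹)))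

/-- The normalization constant `c_n^V`, an integral over Lebesgue measure on `ℂⁿ`. -/
def normConst (V : ℂ → ℝ) (n : ℕ) : ENNReal :=
  ∫⁻ z : Fin n → ℂ, ENNReal.ofReal (weight V n z)

/-- The law `P_n^V` on `ℂⁿ`. -/
def gasLaw (V : ℂ → ℝ) (n : ℕ) : Measure (Fin n → ℂ) :=
  (volume : Measure (Fin n → ℂ)).withDensity
    (fun z => ENNReal.ofReal (weight V n z) / normConst V n)

/-- The uniform probability measure on the unit sphere of the quaternions (normalized surface
measure), viewed as a measure on the quaternions. -/
def sphereUniform : Measure ℍ[ℝ] :=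
  (((volume : Measure ℍ[ℝ]).toSphere Set.univ)⁻¹ • (volume : Measure ℍ[ℝ]).toSphere).map
    Subtype.val

/-- The empirical measure `(1/2n) ∑_{i=1}^{2n} δ_{u_i z_i u_i^*}` of the `2n` points
`z₁, …, z_n, conj z₁, …, conj z_n`, conjugated by the quaternions `u_i`. -/
def conjugatedEmpirical (n : ℕ) (z : Fin n → ℂ) (u : ℕ → ℍ[ℝ]) : Measure ℍ[ℝ] :=
  ((2 * n : ℕ) : ENNReal)⁻¹ •
    ∑ i : Fin (n + n),
      Measure.dirac (u i * (Quaternion.coeComplex (withConj z i)) * star (u i))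

/-- Almost sure weak convergence of random measures to a deterministic measure. -/
def ConvergesAlmostSurely {Ω : Type*} [MeasurableSpace Ω] (P : Measure Ω)
    (m : ℕ → Ω → Measure ℍ[ℝ]) (ν : Measure ℍ[ℝ]) : Prop :=
  ∀ᵐ ω ∂P, ∀ f : ℍ[ℝ] →ᵇ ℝ,
    Tendsto (fun n => ∫ q, f q ∂(m n ω)) atTop (𝓝 (∫ q, f q ∂ν))

/-- Weak convergence in probability of random measures to a deterministic measure. -/
def ConvergesInProbability {Ω : Type*} [MeasurableSpace Ω] (P : Measure Ω)
    (m : ℕ → Ω → Measure ℍ[ℝ]) (ν : Measure ℍ[ℝ]) : Prop :=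
  ∀ f : ℍ[ℝ] →ᵇ ℝ,
    TendstoInMeasure P (fun n ω => ∫ q, f q ∂(m n ω)) atTop (fun _ => ∫ q, f q ∂ν)

end QuatGas

end

/-!
Conjugation by a unit quaternion preserves the real part and the norm. Hence, if the conjugated
empirical measures converged to the uniform measure on `𝕊(ℍ)`, then most of the points `z_{n,i}`
would have modulus close to `1`, and the mean of `Re z²` over them would be close to the mean of
`2 (Re q)² - 1` over the sphere, which is `-1/2`. Such configurations are called sphere-like below,
and it suffices that their probability under the gas law tends to `0`.

The reason is that the limiting measure `μ` on the unit circle violates the Euler–Lagrange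
condition of the equilibrium problem: with `U(z) = ∫ log |z - w|⁻¹ dμ(w)`, the effective potential
`V + 2 U` vanishes at the origin, because `V 0 = 0` for quadratic `V` and `μ` lives on the unit
circle, whereas its mean under `μ` is positive, because `V ≥ 0` and the logarithmic energy of `μ` is
positive. It is therefore favourable to move a particle from the circle to the origin.

Quantitatively, for points in the unit disc `|x - y| ≤ |1 - x ȳ|`, and
`-∑_{i,j} (log |1 - z_i z̄_j| + log |1 - z_i z_j|) = ∑_k (2 / k) (∑_i Re z_i ^ k) ^ 2`.
Keeping only `k = 2` bounds the logarithmic energy from below by the second moment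
(`sum_pairLog_le`). Averaging over the particles near the circle shows that for some `i` the
replacement of `z_i` by a point near the origin multiplies the density by `exp (c n)`
(`exists_le_moveGain`). The few particles away from the circle may come close to the new point;
averaging its position over a small square tames the logarithmic singularities
(`ofReal_le_lintegral_exp_of_negLog_le`). Since only one coordinate is resampled, Tonelli's theorem
in that coordinate bounds the probability of the configurations for which a given `i` works by
`O(exp (-c n))` (`gasLaw_le_of_le_lintegral_update`), and a union bound over `i` concludes.
-/

namespace QuatGas

/-! ### Logarithmic energy of points near the unit circle -/

/-- The logarithmic interaction of a particle at `x` with a particle at `y` and its mirror image. -/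
noncomputable def pairLog (x y : ℂ) : ℝ := Real.log ‖x - y‖ + Real.log ‖x - conj y‖

lemma pairLog_comm (x y : ℂ) : pairLog x y = pairLog y x := by
  have h : ‖x - conj y‖ = ‖y - conj x‖ := by
    rw [← Complex.norm_conj (x - conj y), map_sub, Complex.conj_conj, norm_sub_rev]
  rw [pairLog, pairLog, norm_sub_rev, h]

lemma hasSum_neg_log_norm_one_sub {w : ℂ} (hw : ‖w‖ < 1) :
    HasSum (fun k : ℕ => (w ^ k).re / k) (-Real.log ‖1 - w‖) := by
  have h := Complex.hasSum_re (Complex.hasSum_taylorSeries_neg_log hw)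
  simpa [Complex.log_re, ← Complex.ofReal_natCast, Complex.div_ofReal_re] using h

/-- The kernel `-(log |1 - x ȳ| + log |1 - x y|)` is positive definite on the unit disc; keeping
only the second term of its power series gives a quantitative bound. -/
lemma sum_log_norm_one_sub_le {ι : Type*} (s : Finset ι) (w : ι → ℂ) (hw : ∀ i ∈ s, ‖w i‖ < 1) :
    ∑ i ∈ s, ∑ j ∈ s, (Real.log ‖1 - w i * conj (w j)‖ + Real.log ‖1 - w i * w j‖)
      ≤ -(∑ i ∈ s, (w i ^ 2).re) ^ 2 := by
  have hsum : HasSum (fun k : ℕ => 2 / (k : ℝ) * (∑ i ∈ s, (w i ^ k).re) ^ 2)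
      (∑ i ∈ s, ∑ j ∈ s, (-Real.log ‖1 - w i * conj (w j)‖ + -Real.log ‖1 - w i * w j‖)) := by
    have h1 : HasSum (fun k : ℕ => ∑ i ∈ s, ∑ j ∈ s,
        (((w i * conj (w j)) ^ k).re / k + ((w i * w j) ^ k).re / (k : ℝ)))
        (∑ i ∈ s, ∑ j ∈ s, (-Real.log ‖1 - w i * conj (w j)‖ + -Real.log ‖1 - w i * w j‖)) := by
      refine hasSum_sum fun i hi => hasSum_sum fun j hj => ?_
      have hij : ‖w i‖ * ‖w j‖ < 1 :=
        mul_lt_one_of_nonneg_of_lt_one_left (norm_nonneg _) (hw i hi) (hw j hj).le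
      exact (hasSum_neg_log_norm_one_sub (by simpa using hij)).add
        (hasSum_neg_log_norm_one_sub (by simpa using hij))
    convert h1 using 2 with k
    rw [sq, Finset.sum_mul_sum, Finset.mul_sum]
    refine Finset.sum_congr rfl fun i _ => ?_
    rw [Finset.mul_sum]
    refine Finset.sum_congr rfl fun j _ => ?_
    rw [mul_pow, mul_pow, ← map_pow, Complex.mul_re, Complex.mul_re, Complex.conj_re,
      Complex.conj_im]
    ring
  have h2 := le_hasSum hsum 2 fun k _ => by positivity
  simp only [← neg_add, Finset.sum_neg_distrib] at h2
  push_cast at h2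
  linarith

lemma norm_sub_le_norm_one_sub_mul_conj {x y : ℂ} (hx : ‖x‖ ≤ 1) (hy : ‖y‖ ≤ 1) :
    ‖x - y‖ ≤ ‖1 - x * conj y‖ := by
  have key : 0 ≤ (1 - ‖x‖ ^ 2) * (1 - ‖y‖ ^ 2) :=
    mul_nonneg (by nlinarith [norm_nonneg x]) (by nlinarith [norm_nonneg y])
  refine le_of_sq_le_sq ?_ (norm_nonneg _)
  rw [Complex.sq_norm, Complex.sq_norm] at *
  simp only [Complex.normSq_apply, Complex.sub_re, Complex.sub_im, Complex.mul_re, Complex.mul_im,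
    Complex.conj_re, Complex.conj_im, Complex.one_re, Complex.one_im] at *
  nlinarith

lemma log_norm_sub_le {x y : ℂ} {R : ℝ} (hR : 0 < R) (hx : ‖x‖ ≤ R) (hy : ‖y‖ ≤ R)
    (hxy : x ≠ y) :
    Real.log ‖x - y‖ ≤ Real.log R + Real.log ‖1 - x / R * conj (y / R)‖ := by
  have hR' : (R : ℂ) ≠ 0 := by exact_mod_cast hR.ne'
  have h1 : ‖x - y‖ = R * ‖x / R - y / R‖ := by
    rw [← sub_div, norm_div, Complex.norm_real, Real.norm_of_nonneg hR.le]
    field_simp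
  have h2 : 0 < ‖x / R - y / R‖ := by
    rw [norm_pos_iff, ← sub_div]
    exact div_ne_zero (sub_ne_zero.2 hxy) hR'
  have hn : ∀ u : ℂ, ‖u‖ ≤ R → ‖u / R‖ ≤ 1 := fun u hu => by
    rw [norm_div, Complex.norm_real, Real.norm_of_nonneg hR.le]
    exact (div_le_one hR).2 hu
  rw [h1, Real.log_mul hR.ne' h2.ne']
  gcongr
  exact norm_sub_le_norm_one_sub_mul_conj (hn x hx) (hn y hy)

/-- Upper bound for the logarithmic energy of points in the disc of radius `r < R` and of their
mirror images. The right-hand side involves the points only through their second moment. -/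
lemma sum_pairLog_le {ι : Type*} [DecidableEq ι] (s : Finset ι) (z : ι → ℂ) {r R : ℝ}
    (hr : 0 ≤ r) (hrR : r < R) (hR : 1 ≤ R) (hz : ∀ i ∈ s, ‖z i‖ ≤ r)
    (hne : ∀ i j, i ≠ j → z i ≠ z j) (hne' : ∀ i j, z i ≠ conj (z j)) :
    ∑ i ∈ s, (∑ j ∈ s.erase i, pairLog (z i) (z j) + Real.log ‖z i - conj (z i)‖)
      ≤ 2 * s.card ^ 2 * Real.log R - s.card * Real.log (1 - (r / R) ^ 2)
        - ((∑ i ∈ s, (z i ^ 2).re) / R ^ 2) ^ 2 := by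
  have hR0 : 0 < R := by linarith
  have hlogR : 0 ≤ Real.log R := Real.log_nonneg hR
  have hq : (r / R) ^ 2 < 1 := by
    have h0 : 0 ≤ r / R := by positivity
    have h1 : r / R < 1 := (div_lt_one hR0).2 hrR
    nlinarith
  set w : ι → ℂ := fun i => z i / R with hw
  have hwn : ∀ i ∈ s, ‖w i‖ ≤ r / R := fun i hi => by
    rw [hw]; simp only [norm_div, Complex.norm_real, Real.norm_of_nonneg hR0.le]
    gcongr; exact hz i hi
  have hw1 : ∀ i ∈ s, ‖w i‖ < 1 := fun i hi =>
    (hwn i hi).trans_lt ((div_lt_one hR0).2 hrR)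
  have hsq : ∑ i ∈ s, (w i ^ 2).re = (∑ i ∈ s, (z i ^ 2).re) / R ^ 2 := by
    rw [Finset.sum_div]
    refine Finset.sum_congr rfl fun i _ => ?_
    rw [hw]; simp only [div_pow]
    rw [← Complex.ofReal_pow, Complex.div_ofReal_re]
  -- the diagonal terms of the positive definite kernel are missing on the left; they are added at
  -- the cost of `log (1 - (r / R) ^ 2)` each, which is why `R` exceeds the radius `r`
  have hle : ∀ i ∈ s, ∑ j ∈ s.erase i, pairLog (z i) (z j) + Real.log ‖z i - conj (z i)‖ ≤
      ∑ j ∈ s, (2 * Real.log R + (Real.log ‖1 - w i * conj (w j)‖ + Real.log ‖1 - w i * w j‖))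
        - Real.log (1 - (r / R) ^ 2) := by
    intro i hi
    have hzi := (hz i hi).trans hrR.le
    have hc : ∀ j ∈ s, Real.log ‖z i - conj (z j)‖ ≤ Real.log R + Real.log ‖1 - w i * w j‖ := by
      intro j hj
      have hzj := (hz j hj).trans hrR.le
      have := log_norm_sub_le hR0 hzi (y := conj (z j)) (by simpa using hzj) (hne' i j)
      simpa [hw] using this
    rw [← Finset.sum_erase_add s _ hi]
    have h1 : ∑ j ∈ s.erase i, pairLog (z i) (z j) ≤ ∑ j ∈ s.erase i, (2 * Real.log R +
        (Real.log ‖1 - w i * conj (w j)‖ + Real.log ‖1 - w i * w j‖)) := by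
      refine Finset.sum_le_sum fun j hj => ?_
      have hj' := Finset.mem_of_mem_erase hj
      have := log_norm_sub_le hR0 hzi ((hz j hj').trans hrR.le)
        (hne i j (Finset.ne_of_mem_erase hj).symm)
      have := hc j hj'
      rw [pairLog]
      simp only [hw] at *
      linarith
    have h2 : Real.log (1 - (r / R) ^ 2) ≤ Real.log ‖1 - w i * conj (w i)‖ := by
      have hn := hwn i hi
      have hnn : ‖w i‖ ^ 2 ≤ (r / R) ^ 2 := by gcongr
      refine Real.log_le_log (by linarith) ?_
      have h3 : ‖w i * conj (w i)‖ = ‖w i‖ ^ 2 := by rw [norm_mul, Complex.norm_conj, sq]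
      have h4 := norm_sub_norm_le (1 : ℂ) (w i * conj (w i))
      rw [norm_one, h3] at h4
      linarith
    have h5 := hc i hi
    linarith
  refine (Finset.sum_le_sum hle).trans ?_
  have hmain := sum_log_norm_one_sub_le s w hw1
  rw [hsq] at hmain
  simp only [Finset.sum_sub_distrib, Finset.sum_add_distrib, Finset.sum_const, nsmul_eq_mul] at *
  nlinarith

/-! ### The density as a sum over free points, and moving one particle -/

/-- The logarithm of the unnormalized density, written as a sum over the `n` free points only. -/
noncomputable def logWeight (V : ℂ → ℝ) (n : ℕ) (z : Fin n → ℂ) : ℝ :=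
  ∑ i, ∑ j ∈ Finset.univ.erase i, pairLog (z i) (z j)
    + 2 * ∑ i, Real.log ‖z i - conj (z i)‖ - 2 * n * ∑ i, V (z i)

lemma weight_eq_exp_logWeight {V : ℂ → ℝ} (hV : ∀ x, V (conj x) = V x) (n : ℕ) (z : Fin n → ℂ) :
    weight V n z = Real.exp (logWeight V n z) := by
  have hcc : ∀ i j, ‖conj (z i) - conj (z j)‖ = ‖z i - z j‖ := fun i j => by
    rw [← map_sub, Complex.norm_conj]
  have hc : ∀ i j, ‖conj (z i) - z j‖ = ‖z i - conj (z j)‖ := fun i j => by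
    rw [← Complex.norm_conj, map_sub, Complex.conj_conj]
  have hoff : ∀ F : Fin n → Fin n → ℝ,
      ∑ i, ∑ j ∈ Finset.univ.erase i, F i j = ∑ i, ∑ j, if i ≠ j then F i j else 0 := by
    intro F
    refine Finset.sum_congr rfl fun i _ => ?_
    rw [← Finset.sum_filter]
    congr 1
    ext j
    simp [eq_comm]
  have hsplit : energySum V n z = -2 * (∑ i, ∑ j ∈ Finset.univ.erase i, pairLog (z i) (z j))
      - 2 * ∑ i, Real.log ‖z i - conj (z i)‖ + (4 * n - 2) * ∑ i, V (z i) := by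
    have h1 : energySum V n z = ∑ i, ∑ j, ((if i ≠ j then -2 * pairLog (z i) (z j) else 0)
        - (if i = j then 2 * Real.log ‖z i - conj (z i)‖ + 2 * V (z i) else 0)
        + 2 * V (z i) + 2 * V (z j)) := by
      have e1 : ∀ i j : Fin n, Fin.castAdd n i ≠ Fin.natAdd n j := fun i j h => by
        have := congrArg Fin.val h; simp at this; omega
      simp only [energySum, Fin.sum_univ_add, withConj, Fin.append_left, Fin.append_right]
      simp only [← Finset.sum_add_distrib]
      refine Finset.sum_congr rfl fun i _ => Finset.sum_congr rfl fun j _ => ?_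
      have e3 : ∀ i j : Fin n, (Fin.castAdd n i = Fin.castAdd n j) = (i = j) := fun i j =>
        propext (Fin.castAdd_inj)
      have e4 : ∀ i j : Fin n, (Fin.natAdd n i = Fin.natAdd n j) = (i = j) := fun i j =>
        propext (Fin.natAdd_inj n)
      simp only [ne_eq, e1, (e1 _ _).symm, e3, e4, not_false_eq_true, if_true, kernelFn,
        Real.log_inv, hcc, hc, hV, pairLog]
      by_cases h : i = j
      · subst h; simp; ring
      · simp [h]; ring
    rw [h1]
    simp only [Finset.sum_add_distrib, Finset.sum_sub_distrib, ← hoff, Finset.sum_ite_eq,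
      Finset.mem_univ, if_true, Finset.sum_const, Finset.card_univ, Fintype.card_fin,
      nsmul_eq_mul, ← Finset.mul_sum]
    ring
  rw [weight, hsplit, logWeight]
  congr 1
  simp only [Fin.sum_univ_add, withConj, Fin.append_left, Fin.append_right, hV, Complex.conj_conj,
    hc, Real.log_inv, Finset.sum_neg_distrib]
  ring

lemma measurable_logWeight {V : ℂ → ℝ} (hV : Measurable V) (n : ℕ) :
    Measurable (logWeight V n) := by
  have h : ∀ i : Fin n, Measurable fun z : Fin n → ℂ => conj (z i) := fun i =>
    Complex.continuous_conj.measurable.comp (measurable_pi_apply i)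
  unfold logWeight pairLog
  fun_prop

lemma sum_erase_sum_erase {ι : Type*} [Fintype ι] [DecidableEq ι] {F : ι → ι → ℝ}
    (hF : ∀ a b, F a b = F b a) (i : ι) :
    ∑ a, ∑ b ∈ Finset.univ.erase a, F a b = 2 * ∑ b ∈ Finset.univ.erase i, F i b
      + ∑ a ∈ Finset.univ.erase i, ∑ b ∈ (Finset.univ.erase a).erase i, F a b := by
  rw [← Finset.sum_erase_add _ _ (Finset.mem_univ i)]
  have : ∀ a ∈ Finset.univ.erase i, ∑ b ∈ Finset.univ.erase a, F a b
      = ∑ b ∈ (Finset.univ.erase a).erase i, F a b + F i a := fun a ha => by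
    rw [← Finset.sum_erase_add _ _ (Finset.mem_erase.2
      ⟨(Finset.ne_of_mem_erase ha).symm, Finset.mem_univ i⟩), hF a i]
  rw [Finset.sum_congr rfl this, Finset.sum_add_distrib]
  ring

lemma logWeight_update (V : ℂ → ℝ) {n : ℕ} (z : Fin n → ℂ) (i : Fin n) (y : ℂ) :
    logWeight V n (Function.update z i y) = logWeight V n z
      + 2 * ∑ j ∈ Finset.univ.erase i, (pairLog y (z j) - pairLog (z i) (z j))
      + 2 * (Real.log ‖y - conj y‖ - Real.log ‖z i - conj (z i)‖) - 2 * n * (V y - V (z i)) := by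
  have hu : ∀ j ∈ Finset.univ.erase i, Function.update z i y j = z j := fun j hj =>
    Function.update_of_ne (Finset.ne_of_mem_erase hj) _ _
  have hpair := fun u : Fin n → ℂ =>
    sum_erase_sum_erase (F := fun a b => pairLog (u a) (u b)) (fun a b => pairLog_comm _ _) i
  have hrest : ∑ a ∈ Finset.univ.erase i, ∑ b ∈ (Finset.univ.erase a).erase i,
      pairLog (Function.update z i y a) (Function.update z i y b)
      = ∑ a ∈ Finset.univ.erase i, ∑ b ∈ (Finset.univ.erase a).erase i, pairLog (z a) (z b) :=
    Finset.sum_congr rfl fun a ha => Finset.sum_congr rfl fun b hb => by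
      rw [hu a ha, hu b (Finset.mem_erase.2 ⟨Finset.ne_of_mem_erase hb, Finset.mem_univ b⟩)]
  have hone : ∀ f : ℂ → ℝ, ∑ a, f (Function.update z i y a) = ∑ a, f (z a) + (f y - f (z i)) := by
    intro f
    rw [← Finset.sum_erase_add _ _ (Finset.mem_univ i),
      ← Finset.sum_erase_add Finset.univ (fun a => f (z a)) (Finset.mem_univ i),
      Finset.sum_congr rfl fun a ha => by rw [hu a ha], Function.update_self]
    ring
  have hself : ∑ b ∈ Finset.univ.erase i,
      pairLog (Function.update z i y i) (Function.update z i y b)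
      = ∑ b ∈ Finset.univ.erase i, pairLog y (z b) :=
    Finset.sum_congr rfl fun b hb => by rw [hu b hb, Function.update_self]
  rw [logWeight, logWeight, hpair, hpair z, hrest, hself, hone V,
    hone fun x => Real.log ‖x - conj x‖, Finset.sum_sub_distrib]
  ring

/-- The function `min (log |t|) 0`, with value `0` at the singularity `t = 0`. -/
noncomputable def negLog (t : ℝ) : ℝ := min 0 (Real.log t)

lemma integrable_negLog : Integrable negLog := by
  have h1 : IntegrableOn Real.log (Set.Ioc (-1) 1) :=
    (intervalIntegrable_iff_integrableOn_Ioc_of_le (by norm_num)).1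
      intervalIntegral.intervalIntegrable_log'
  have h2 : negLog = (Set.Ioc (-1 : ℝ) 1).indicator Real.log := by
    funext t
    by_cases ht : t ∈ Set.Ioc (-1 : ℝ) 1
    · rw [Set.indicator_of_mem ht, negLog, min_eq_right]
      rw [← Real.log_abs]
      exact Real.log_nonpos (abs_nonneg t) (abs_le.2 ⟨ht.1.le, ht.2⟩)
    · rw [Set.indicator_of_notMem ht, negLog, min_eq_left]
      rw [← Real.log_abs]
      refine Real.log_nonneg ?_
      by_contra h
      rw [not_le, abs_lt] at h
      exact ht ⟨h.1, h.2.le⟩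
  rw [h2]
  exact h1.integrable_indicator measurableSet_Ioc

lemma negLog_nonpos (t : ℝ) : negLog t ≤ 0 := min_le_left _ _

lemma integral_negLog_le_setIntegral_sub (a : ℝ) (s : Set ℝ) :
    ∫ t, negLog t ≤ ∫ x in s, negLog (x - a) := by
  have hi : Integrable (fun x => negLog (x - a)) := integrable_negLog.comp_sub_right a
  have h1 : ∫ x in s, -negLog (x - a) ≤ ∫ x, -negLog (x - a) :=
    setIntegral_le_integral hi.neg (ae_of_all _ fun x => neg_nonneg.2 (negLog_nonpos _))
  have h2 := integral_sub_right_eq_self (μ := volume) negLog a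
  rw [integral_neg, integral_neg, h2] at h1
  linarith

/-! ### The gain from moving a particle to the origin -/

/-- The bound depends on `y` through its real part only, so that it can be averaged over a
segment. -/
lemma negLog_sub_log_six_le {y p a : ℂ} (hy : ‖y‖ ≤ 1 / 2) (hp : ‖p‖ ≤ 2) (hpa : p ≠ a)
    (hya : y.re ≠ a.re) :
    negLog (y.re - a.re) - Real.log 6 ≤ Real.log ‖y - a‖ - Real.log ‖p - a‖ := by
  have hpa0 : 0 < ‖p - a‖ := norm_pos_iff.2 (sub_ne_zero.2 hpa)
  have hya0 : 0 < ‖y - a‖ := norm_pos_iff.2 (sub_ne_zero.2 fun h => hya (by rw [h]))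
  have h1 := norm_sub_le p a
  by_cases ha : 1 ≤ ‖a‖
  · have h2 := norm_sub_norm_le a y
    rw [norm_sub_rev] at h2
    have h3 : Real.log ‖p - a‖ ≤ Real.log (6 * ‖y - a‖) := Real.log_le_log hpa0 (by linarith)
    rw [Real.log_mul (by norm_num) hya0.ne'] at h3
    linarith [negLog_nonpos (y.re - a.re)]
  · have h3 : Real.log ‖p - a‖ ≤ Real.log 6 := Real.log_le_log hpa0 (by linarith)
    have h4 : Real.log |y.re - a.re| ≤ Real.log ‖y - a‖ :=
      Real.log_le_log (abs_pos.2 (sub_ne_zero.2 hya)) (by simpa using Complex.abs_re_le_norm (y - a))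
    rw [Real.log_abs] at h4
    have h5 : negLog (y.re - a.re) ≤ Real.log (y.re - a.re) := min_le_right _ _
    linarith

lemma neg_inv_fifty_le_log_norm_sub {y a : ℂ} (h : 99 / 100 ≤ ‖a‖ - ‖y‖) :
    -(1 / 50) ≤ Real.log ‖y - a‖ := by
  have h1 := norm_sub_norm_le a y
  rw [norm_sub_rev] at h1
  have h2 : Real.log (99 / 100) ≤ Real.log ‖y - a‖ := Real.log_le_log (by norm_num) (by linarith)
  have h3 := Real.one_sub_inv_le_log_of_pos (show (0 : ℝ) < 99 / 100 by norm_num)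
  norm_num at h3
  linarith

/-- A lower bound for the gain in log-weight when the particle `i` is moved to a point near the
origin, up to a term that depends on the new position `y` (see `moveGain_le_logWeight_update`). The
set `s` consists of the particles close to the unit circle, `v` bounds the potential near the
origin, and `2 δ` is a lower bound for `|y - ȳ|`. -/
noncomputable def moveGain {n : ℕ} (s : Finset (Fin n)) (z : Fin n → ℂ) (v δ : ℝ) (i : Fin n) :
    ℝ :=
  -(2 * (∑ j ∈ s.erase i, pairLog (z i) (z j) + Real.log ‖z i - conj (z i)‖))
    - 2 / 25 * n - 4 * sᶜ.card * Real.log 6 + 2 * Real.log (2 * δ) - 2 * n * v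

lemma moveGain_le_logWeight_update {V : ℂ → ℝ} (hV0 : ∀ x, 0 ≤ V x) {n : ℕ} {z : Fin n → ℂ}
    (hne : ∀ i j, i ≠ j → z i ≠ z j) (hne' : ∀ i j, z i ≠ conj (z j)) {s : Finset (Fin n)}
    {ε δ v : ℝ} (hε : 0 ≤ ε) (hδ : 0 < δ) (hεδ : ε + 3 * δ ≤ 1 / 100)
    (hs : ∀ j ∈ s, |‖z j‖ - 1| ≤ ε) (hv : ∀ y : ℂ, ‖y‖ ≤ 3 * δ → V y ≤ v) {i : Fin n}
    (hi : i ∈ s) {y : ℂ} (hre : y.re ∈ Set.Icc 0 δ) (him : y.im ∈ Set.Icc δ (2 * δ))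
    (hy : ∀ j ∈ sᶜ, y.re ≠ (z j).re) :
    logWeight V n z + moveGain s z v δ i + 4 * ∑ j ∈ sᶜ, negLog (y.re - (z j).re)
      ≤ logWeight V n (Function.update z i y) := by
  have hyn : ‖y‖ ≤ 3 * δ := by
    refine (Complex.norm_le_abs_re_add_abs_im y).trans ?_
    rw [abs_of_nonneg hre.1, abs_of_nonneg (hδ.le.trans him.1)]
    linarith [hre.2, him.2]
  have hzi : ‖z i‖ ≤ 2 := by
    have := (abs_le.1 (hs i hi)).2
    linarith
  -- particles near the circle repel the point `y` by almost nothing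
  have hgood : ∀ j ∈ s, -(1 / 25) ≤ pairLog y (z j) := fun j hj => by
    have h1 := (abs_le.1 (hs j hj)).1
    have h2 := neg_inv_fifty_le_log_norm_sub (y := y) (a := z j) (by linarith)
    have h3 := neg_inv_fifty_le_log_norm_sub (y := y) (a := conj (z j))
      (by rw [Complex.norm_conj]; linarith)
    rw [pairLog]
    linarith
  -- a stray particle may come close to `y`, or lie far away from both `y` and `z i`
  have hbad : ∀ j ∈ sᶜ, 2 * negLog (y.re - (z j).re) - 2 * Real.log 6
      ≤ pairLog y (z j) - pairLog (z i) (z j) := fun j hj => by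
    have hij : i ≠ j := fun h => (Finset.mem_compl.1 hj) (h ▸ hi)
    have h2 := negLog_sub_log_six_le (y := y) (a := z j) (by linarith) hzi (hne i j hij) (hy j hj)
    have h3 := negLog_sub_log_six_le (y := y) (a := conj (z j)) (by linarith) hzi (hne' i j)
      (by simpa using hy j hj)
    rw [Complex.conj_re] at h3
    rw [pairLog, pairLog]
    linarith
  have hsplit : Finset.univ.erase i = s.erase i ∪ sᶜ := by
    ext j
    by_cases hj : j ∈ s
    · simp [hj]
    · have : j ≠ i := fun h => hj (h ▸ hi)
      simp [hj, this]
  have hdisj : Disjoint (s.erase i) sᶜ :=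
    disjoint_compl_right.mono_left (Finset.erase_subset i s)
  have hlog : Real.log (2 * δ) ≤ Real.log ‖y - conj y‖ := by
    refine Real.log_le_log (by linarith) ?_
    have h1 := Complex.abs_im_le_norm (y - conj y)
    rw [Complex.sub_im, Complex.conj_im, sub_neg_eq_add] at h1
    have h2 := le_abs_self (y.im + y.im)
    linarith [him.1]
  have hsumgood : -(1 / 25) * (n : ℝ) ≤ ∑ j ∈ s.erase i, pairLog y (z j) := by
    have h1 : ∑ j ∈ s.erase i, -(1 / 25 : ℝ) ≤ ∑ j ∈ s.erase i, pairLog y (z j) :=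
      Finset.sum_le_sum fun j hj => hgood j (Finset.mem_of_mem_erase hj)
    have h2 : ((s.erase i).card : ℝ) ≤ n := by
      exact_mod_cast (Finset.card_le_univ _).trans_eq (Fintype.card_fin n)
    rw [Finset.sum_const, nsmul_eq_mul] at h1
    linarith
  have hsumbad := Finset.sum_le_sum hbad
  rw [Finset.sum_sub_distrib, ← Finset.mul_sum, Finset.sum_const, nsmul_eq_mul] at hsumbad
  have hVy := mul_le_mul_of_nonneg_left (hv y hyn) (Nat.cast_nonneg (α := ℝ) n)
  have hVz := mul_nonneg (Nat.cast_nonneg (α := ℝ) n) (hV0 (z i))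
  rw [logWeight_update, hsplit, Finset.sum_union hdisj, Finset.sum_sub_distrib, moveGain]
  linarith

/-- Averaging over the particles near the circle, some particle gains a lot: the logarithmic
energy of these particles is at least about `n² / 4`, while at the origin both the potential and
the logarithmic potential of the particles are negligible. -/
lemma exists_le_moveGain {n : ℕ} (hn : 0 < n) {z : Fin n → ℂ}
    (hne : ∀ i j, i ≠ j → z i ≠ z j) (hne' : ∀ i j, z i ≠ conj (z j)) {s : Finset (Fin n)}
    {ε δ : ℝ} (hε : 0 < ε) (hε' : ε ≤ 1 / 1000)
    (hs : ∀ j ∈ s, |‖z j‖ - 1| ≤ ε) (hcard : (sᶜ.card : ℝ) ≤ ε * n)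
    (hsq : ∑ i ∈ s, (z i ^ 2).re ≤ -(9 / 20) * n) :
    ∃ i ∈ s, n / 5 + 2 * Real.log (2 * δ) + 2 * Real.log (1 - ((1 + ε) / (1 + 2 * ε)) ^ 2)
      ≤ moveGain s z (1 / 100) δ i := by
  set c := Real.log (1 - ((1 + ε) / (1 + 2 * ε)) ^ 2) with hc
  set d := Real.log (2 * δ) with hd
  have hn' : (0 : ℝ) < n := by exact_mod_cast hn
  have hE := sum_pairLog_le s z (r := 1 + ε) (R := 1 + 2 * ε) (by linarith) (by linarith)
    (by linarith) (fun i hi => by linarith [(abs_le.1 (hs i hi)).2]) hne hne'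
  rw [← hc] at hE
  have hm : (s.card : ℝ) ≤ n := by
    exact_mod_cast (Finset.card_le_univ _).trans_eq (Fintype.card_fin n)
  have hlogR : Real.log (1 + 2 * ε) ≤ 1 / 500 := by
    have := Real.log_le_sub_one_of_pos (show 0 < 1 + 2 * ε by linarith)
    linarith
  have hlogR0 : 0 ≤ Real.log (1 + 2 * ε) := Real.log_nonneg (by linarith)
  have hlog6 : Real.log 6 ≤ 5 := by
    have := Real.log_le_sub_one_of_pos (show (0 : ℝ) < 6 by norm_num)
    linarith
  have hlog60 : 0 ≤ Real.log 6 := Real.log_nonneg (by norm_num)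
  have hquad : (1 / 5) * (n : ℝ) ^ 2 ≤ ((∑ i ∈ s, (z i ^ 2).re) / (1 + 2 * ε) ^ 2) ^ 2 := by
    rw [div_pow, ← pow_mul, le_div_iff₀ (by positivity)]
    have h1 : (1 + 2 * ε) ^ (2 * 2) ≤ (501 / 500) ^ 4 :=
      pow_le_pow_left₀ (by linarith) (by linarith) 4
    have h2 : (9 / 20 * (n : ℝ)) ^ 2 ≤ (∑ i ∈ s, (z i ^ 2).re) ^ 2 := by
      rw [sq_le_sq, abs_of_nonneg (by positivity)]
      exact (by linarith : 9 / 20 * (n : ℝ) ≤ -∑ i ∈ s, (z i ^ 2).re).trans (neg_le_abs _)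
    nlinarith
  have hsc : (s.card : ℝ) * (4 * sᶜ.card * Real.log 6) ≤ 1 / 50 * (n : ℝ) ^ 2 := by
    have h1 : 4 * sᶜ.card * Real.log 6 ≤ 4 * (1 / 1000 * n) * 5 := by
      gcongr
      exact hcard.trans (by gcongr)
    calc (s.card : ℝ) * (4 * sᶜ.card * Real.log 6) ≤ n * (4 * (1 / 1000 * n) * 5) := by gcongr
      _ = 1 / 50 * (n : ℝ) ^ 2 := by ring
  have hsR : 2 * (s.card : ℝ) ^ 2 * Real.log (1 + 2 * ε) ≤ 1 / 250 * (n : ℝ) ^ 2 := by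
    calc 2 * (s.card : ℝ) ^ 2 * Real.log (1 + 2 * ε) ≤ 2 * (n : ℝ) ^ 2 * (1 / 500) := by gcongr
      _ = 1 / 250 * (n : ℝ) ^ 2 := by ring
  have hsn : (s.card : ℝ) * n ≤ (n : ℝ) ^ 2 := by nlinarith
  by_contra! hcon
  have hle : ∑ i ∈ s, moveGain s z (1 / 100) δ i ≤ ∑ i ∈ s, ((n : ℝ) / 5 + 2 * d + 2 * c) :=
    Finset.sum_le_sum fun i hi => (hcon i hi).le
  simp only [moveGain, Finset.sum_sub_distrib, Finset.sum_add_distrib, Finset.sum_neg_distrib,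
    ← Finset.mul_sum, Finset.sum_const, nsmul_eq_mul] at hle
  rw [Finset.sum_add_distrib] at hE
  have : (0 : ℝ) < (n : ℝ) ^ 2 := by positivity
  nlinarith

/-! ### Resampling one coordinate -/

lemma ofReal_integral_le_lintegral_ofReal {α : Type*} [MeasurableSpace α] {μ : Measure α}
    {f : α → ℝ} (hf : Integrable f μ) :
    ENNReal.ofReal (∫ x, f x ∂μ) ≤ ∫⁻ x, ENNReal.ofReal (f x) ∂μ := by
  rw [integral_eq_lintegral_pos_part_sub_lintegral_neg_part hf]
  exact (ENNReal.ofReal_le_ofReal (sub_le_self _ ENNReal.toReal_nonneg)).trans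
    ENNReal.ofReal_toReal_le

lemma setLIntegral_reProdIm {A B : Set ℝ} {f : ℂ → ENNReal} (hf : Measurable f) :
    ∫⁻ y in A ×ℂ B, f y = ∫⁻ t in B, ∫⁻ x in A, f ⟨x, t⟩ := by
  have h := Complex.volume_preserving_equiv_real_prod.symm.setLIntegral_comp_preimage_emb
    Complex.measurableEquivRealProd.symm.measurableEmbedding f (A ×ℂ B)
  have hpre : (Complex.measurableEquivRealProd.symm ⁻¹' (A ×ℂ B)) = A ×ˢ B := by
    ext p
    simp [Complex.mem_reProdIm, Complex.measurableEquivRealProd]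
  rw [← h, hpre, Measure.volume_eq_prod, ← Measure.prod_restrict, lintegral_prod_symm']
  · rfl
  · exact hf.comp Complex.measurableEquivRealProd.symm.measurable

/-- Jensen's inequality for the exponential, in the form `exp t ≥ 1 + t`: the logarithmic
singularities at the stray particles cost at most a factor exponential in their number. -/
lemma ofReal_le_lintegral_exp_of_negLog_le {ι : Type*} (s : Finset ι) (a : ι → ℝ) {δ c : ℝ}
    (hδ : 0 < δ) {F : ℝ → ℝ}
    (hF : ∀ x ∈ Set.Icc 0 δ, (∀ i ∈ s, x ≠ a i) → c + 4 * ∑ i ∈ s, negLog (x - a i) ≤ F x) :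
    ENNReal.ofReal (δ * Real.exp (c + 4 * s.card * (∫ t, negLog t) / δ)) ≤
      ∫⁻ x in Set.Icc 0 δ, ENNReal.ofReal (Real.exp (F x)) := by
  set N := ∫ t, negLog t with hN
  set M := 4 * s.card * N / δ with hM
  have hi : ∀ i ∈ s, Integrable (fun x => negLog (x - a i)) (volume.restrict (Set.Icc 0 δ)) :=
    fun i _ => (integrable_negLog.comp_sub_right (a i)).restrict
  have hisum := (integrable_finsetSum s hi).const_mul 4
  have hfi : Integrable (fun x => Real.exp (c + M) *
      ((1 - M) + 4 * ∑ i ∈ s, negLog (x - a i))) (volume.restrict (Set.Icc 0 δ)) :=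
    ((integrable_const _).add hisum).const_mul _
  have hae : ∀ᵐ x ∂(volume.restrict (Set.Icc 0 δ)), ENNReal.ofReal (Real.exp (c + M) *
      ((1 - M) + 4 * ∑ i ∈ s, negLog (x - a i))) ≤ ENNReal.ofReal (Real.exp (F x)) := by
    have hcount : ((s : Set ι).image a).Countable := s.countable_toSet.image a
    filter_upwards [ae_restrict_mem measurableSet_Icc,
      ae_restrict_of_ae (hcount.ae_notMem volume)] with x hx hxa
    refine ENNReal.ofReal_le_ofReal ?_
    have h1 := hF x hx fun i hi h => hxa ⟨i, hi, h.symm⟩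
    have h2 := Real.add_one_le_exp (4 * ∑ i ∈ s, negLog (x - a i) - M)
    calc Real.exp (c + M) * ((1 - M) + 4 * ∑ i ∈ s, negLog (x - a i))
        ≤ Real.exp (c + M) * Real.exp (4 * ∑ i ∈ s, negLog (x - a i) - M) := by
          gcongr; linarith
      _ = Real.exp (c + 4 * ∑ i ∈ s, negLog (x - a i)) := by
          rw [← Real.exp_add]; ring_nf
      _ ≤ Real.exp (F x) := Real.exp_le_exp.2 h1
  refine le_trans (ENNReal.ofReal_le_ofReal ?_)
    ((ofReal_integral_le_lintegral_ofReal hfi).trans (lintegral_mono_ae hae))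
  rw [integral_const_mul, integral_add (integrable_const _) hisum, integral_const_mul,
    integral_finsetSum s hi, setIntegral_const, Real.volume_real_Icc_of_le hδ.le, smul_eq_mul,
    mul_comm δ]
  gcongr
  have h3 : ∑ i ∈ s, N ≤ ∑ i ∈ s, ∫ x in Set.Icc 0 δ, negLog (x - a i) :=
    Finset.sum_le_sum fun i _ => integral_negLog_le_setIntegral_sub (a i) _
  rw [Finset.sum_const, nsmul_eq_mul] at h3
  have h4 : δ * M = 4 * s.card * N := by rw [hM]; field_simp
  linarith

lemma measurable_weight {V : ℂ → ℝ} (hV : IsPotential V) (n : ℕ) : Measurable (weight V n) := by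
  have : weight V n = fun z => Real.exp (logWeight V n z) :=
    funext (weight_eq_exp_logWeight hV.conj_invariant n)
  rw [this]
  exact (measurable_logWeight hV.continuous.measurable n).exp

/-- Configurations without coincidences, also among the mirror images, have full measure. -/
lemma ae_ne_and_ne_conj (n : ℕ) : ∀ᵐ z : Fin n → ℂ,
    (∀ i j, i ≠ j → z i ≠ z j) ∧ ∀ i j, z i ≠ conj (z j) := by
  have hker : ∀ f : (Fin n → ℂ) →ₗ[ℝ] ℂ, f ≠ 0 → ∀ᵐ z, f z ≠ 0 := by
    intro f hf
    have h := Measure.addHaar_submodule (volume : Measure (Fin n → ℂ)) (LinearMap.ker f)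
      (by rwa [Ne, LinearMap.ker_eq_top])
    rw [ae_iff]
    simp only [not_not]
    exact h
  let p : Fin n → (Fin n → ℂ) →ₗ[ℝ] ℂ := fun k => LinearMap.proj k
  refine Filter.Eventually.and (ae_all_iff.2 fun i => ae_all_iff.2 fun j => ?_)
    (ae_all_iff.2 fun i => ae_all_iff.2 fun j => ?_)
  · by_cases hij : i = j
    · exact ae_of_all _ fun z h => absurd hij h
    · have hf : p i - p j ≠ 0 := fun h => by
        have := LinearMap.congr_fun h (Pi.single i 1)
        simp [p, Pi.single_eq_of_ne' hij] at this
      filter_upwards [hker _ hf] with z hz _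
      simpa [p, sub_eq_zero] using hz
  · have hf : p i - Complex.conjAe.toLinearMap ∘ₗ p j ≠ 0 := fun h => by
      have h1 := LinearMap.congr_fun h (Pi.single i Complex.I)
      by_cases hij : i = j
      · subst hij
        simp [p, Complex.ext_iff] at h1
      · simp [p, Pi.single_eq_of_ne' hij] at h1
    filter_upwards [hker _ hf] with z hz
    simpa [p, sub_eq_zero] using hz

/-- If every configuration in `A` has a bounded `i`-th coordinate whose resampling over `D`
multiplies the weight by at least `q` in total, then `A` has probability `O(1 / q)`. -/
lemma gasLaw_le_of_le_lintegral_update {V : ℂ → ℝ} (hV : IsPotential V) {n : ℕ} (i : Fin n)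
    (D : Set ℂ) {q r : ℝ} (hq : 0 < q) :
    gasLaw V n {z | ‖z i‖ ≤ r ∧ ENNReal.ofReal q * ENNReal.ofReal (weight V n z) ≤
      ∫⁻ y in D, ENNReal.ofReal (weight V n (Function.update z i y))}
      ≤ volume (Metric.closedBall (0 : ℂ) r) * (ENNReal.ofReal q)⁻¹ := by
  set W : (Fin n → ℂ) → ENNReal := fun z => ENNReal.ofReal (weight V n z) with hW
  have hWm : Measurable W := (measurable_weight hV n).ennreal_ofReal
  set A : Set (Fin n → ℂ) := {z | ‖z i‖ ≤ r ∧ ENNReal.ofReal q * W z ≤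
    ∫⁻ y in D, W (Function.update z i y)} with hA
  have hq0 : ENNReal.ofReal q ≠ 0 := by simpa using hq
  have hmeas : MeasurableSet A := by
    refine (measurableSet_le ((measurable_pi_apply i).norm) measurable_const).inter
      (measurableSet_le (hWm.const_mul _) ?_)
    exact Measurable.lintegral_prod_right' (f := fun p : (Fin n → ℂ) × ℂ =>
      W (Function.update p.1 i p.2)) (hWm.comp measurable_update')
  set B := Metric.closedBall (0 : ℂ) r with hB
  have hint : ∫⁻ z, A.indicator W z ≤ ∫⁻ z, volume B * (ENNReal.ofReal q)⁻¹ * W z := by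
    rw [volume_pi]
    refine lintegral_le_of_lmarginal_le {i} (hWm.indicator hmeas) (hWm.const_mul _) fun x => ?_
    rw [lmarginal_singleton, lmarginal_singleton]
    set J := ∫⁻ y, W (Function.update x i y) with hJ
    have hpt : ∀ t, A.indicator W (Function.update x i t) ≤
        B.indicator (fun _ => (ENNReal.ofReal q)⁻¹ * J) t := by
      intro t
      by_cases ht : Function.update x i t ∈ A
      · have htB : t ∈ B := by simpa [hB] using ht.1
        rw [Set.indicator_of_mem ht, Set.indicator_of_mem htB,
          ← ENNReal.mul_le_iff_le_inv hq0 ENNReal.ofReal_ne_top]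
        refine ht.2.trans ((setLIntegral_le_lintegral _ _).trans_eq ?_)
        simp only [Function.update_idem, hJ]
      · rw [Set.indicator_of_notMem ht]
        exact zero_le
    refine (lintegral_mono hpt).trans ?_
    have hc := lintegral_const_mul (μ := volume) (volume B * (ENNReal.ofReal q)⁻¹)
      (hWm.comp (measurable_update x (a := i)))
    simp only [Function.comp_apply] at hc
    rw [lintegral_indicator measurableSet_closedBall, setLIntegral_const]
    exact (le_of_eq (by rw [hB]; ring)).trans hc.ge
  have hlaw : gasLaw V n A = (∫⁻ z, A.indicator W z) * (normConst V n)⁻¹ := by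
    rw [gasLaw, withDensity_apply _ hmeas, lintegral_indicator hmeas,
      ← lintegral_mul_const _ hWm]
    simp only [div_eq_mul_inv, hW]
  rw [lintegral_const_mul _ hWm] at hint
  rw [hlaw]
  calc (∫⁻ z, A.indicator W z) * (normConst V n)⁻¹
      ≤ volume B * (ENNReal.ofReal q)⁻¹ * (∫⁻ z, W z) * (normConst V n)⁻¹ := by gcongr
    _ = volume B * (ENNReal.ofReal q)⁻¹ * (normConst V n * (normConst V n)⁻¹) := by
        rw [mul_assoc]; rfl
    _ ≤ volume B * (ENNReal.ofReal q)⁻¹ * 1 := by gcongr; exact ENNReal.mul_inv_le_one _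
    _ = _ := mul_one _

/-! ### Sphere-like configurations are unlikely -/

/-- Configurations whose empirical measure resembles the image of the uniform measure on the
unit sphere of `ℍ` under `q ↦ Re q ± i |Im q|`: most points are close to the unit circle, and
`Re z²` has mean about `-1/2` over these points. -/
def sphereLikeConfigs (ε : ℝ) (n : ℕ) : Set (Fin n → ℂ) :=
  {z | ((Finset.univ.filter fun j => |‖z j‖ - 1| ≤ ε)ᶜ.card : ℝ) ≤ ε * n ∧
    ∑ j with |‖z j‖ - 1| ≤ ε, (z j ^ 2).re ≤ -(9 / 20) * n}

lemma integral_negLog_nonpos : ∫ t, negLog t ≤ 0 :=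
  integral_nonpos fun t => negLog_nonpos t

/-- For a generic sphere-like configuration, resampling a suitable particle over a small square
near the origin multiplies the weight by a factor exponential in `n`. -/
lemma exists_ofReal_mul_weight_le {V : ℂ → ℝ} (hV : IsPotential V) {n : ℕ} (hn : 0 < n)
    {ε δ : ℝ} (hε : 0 < ε) (hε' : ε ≤ 1 / 1000) (hδ : 0 < δ) (hδ' : δ ≤ 1 / 1000)
    (hεδ : ε * (40 * -∫ t, negLog t) ≤ δ) (hv : ∀ y : ℂ, ‖y‖ ≤ 3 * δ → V y ≤ 1 / 100)
    {z : Fin n → ℂ} (hne : ∀ i j, i ≠ j → z i ≠ z j) (hne' : ∀ i j, z i ≠ conj (z j))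
    (hz : z ∈ sphereLikeConfigs ε n) :
    ∃ i, ‖z i‖ ≤ 2 ∧ ENNReal.ofReal (δ ^ 2 * Real.exp (n / 10 +
        (2 * Real.log (2 * δ) + 2 * Real.log (1 - ((1 + ε) / (1 + 2 * ε)) ^ 2))))
        * ENNReal.ofReal (weight V n z) ≤
      ∫⁻ y in Set.Icc 0 δ ×ℂ Set.Icc δ (2 * δ),
        ENNReal.ofReal (weight V n (Function.update z i y)) := by
  set C := 2 * Real.log (2 * δ) + 2 * Real.log (1 - ((1 + ε) / (1 + 2 * ε)) ^ 2) with hC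
  set s : Finset (Fin n) := Finset.univ.filter fun j => |‖z j‖ - 1| ≤ ε with hs
  have hsmem : ∀ j ∈ s, |‖z j‖ - 1| ≤ ε := fun j hj => (Finset.mem_filter.1 hj).2
  obtain ⟨i, hi, hgain⟩ := exists_le_moveGain hn hne hne' hε hε' (δ := δ) hsmem hz.1 hz.2
  refine ⟨i, by linarith [(abs_le.1 (hsmem i hi)).2], ?_⟩
  set c := logWeight V n z + moveGain s z (1 / 100) δ i with hc
  have hM : -((n : ℝ) / 10) ≤ 4 * sᶜ.card * (∫ t, negLog t) / δ := by
    rw [le_div_iff₀ hδ]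
    have h1 := mul_le_mul_of_nonneg_right hz.1 (neg_nonneg.2 integral_negLog_nonpos)
    have h2 := mul_le_mul_of_nonneg_left hεδ (Nat.cast_nonneg (α := ℝ) n)
    linarith
  have hseg : ∀ t ∈ Set.Icc δ (2 * δ),
      ENNReal.ofReal (δ * Real.exp (n / 10 + C + logWeight V n z)) ≤
      ∫⁻ x in Set.Icc 0 δ, ENNReal.ofReal (weight V n (Function.update z i ⟨x, t⟩)) := by
    intro t ht
    simp only [weight_eq_exp_logWeight hV.conj_invariant]
    refine le_trans (ENNReal.ofReal_le_ofReal ?_)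
      (ofReal_le_lintegral_exp_of_negLog_le sᶜ (fun j => (z j).re) hδ (c := c) fun x hx hxa => ?_)
    · exact mul_le_mul_of_nonneg_left (Real.exp_le_exp.2 (by linarith)) hδ.le
    · exact moveGain_le_logWeight_update hV.nonneg hne hne' hε.le hδ (by linarith) hsmem hv hi
        (y := ⟨x, t⟩) hx ht hxa
  have hm : Measurable fun y => ENNReal.ofReal (weight V n (Function.update z i y)) :=
    ((measurable_weight hV n).comp (measurable_update z)).ennreal_ofReal
  rw [setLIntegral_reProdIm hm]
  calc ENNReal.ofReal (δ ^ 2 * Real.exp (n / 10 + C)) * ENNReal.ofReal (weight V n z)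
      = ∫⁻ _ in Set.Icc δ (2 * δ),
          ENNReal.ofReal (δ * Real.exp (n / 10 + C + logWeight V n z)) := by
        rw [setLIntegral_const, Real.volume_Icc, ← ENNReal.ofReal_mul (by positivity),
          ← ENNReal.ofReal_mul (by positivity), weight_eq_exp_logWeight hV.conj_invariant,
          Real.exp_add (n / 10 + C)]
        ring_nf
    _ ≤ _ := setLIntegral_mono' measurableSet_Icc hseg

/-- Sphere-like configurations have vanishing probability under the gas law when the
potential vanishes at the origin. -/
theorem exists_tendsto_gasLaw_sphereLikeConfigs {V : ℂ → ℝ} (hV : IsPotential V) (hV0 : V 0 = 0) :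
    ∃ ε : ℝ, 0 < ε ∧ ε ≤ 1 / 1000 ∧
      Tendsto (fun n => gasLaw V n (sphereLikeConfigs ε n)) atTop (𝓝 0) := by
  obtain ⟨ρ, hρ, hVρ⟩ := Metric.continuous_iff.1 hV.continuous 0 (1 / 100) (by norm_num)
  set δ := min (1 / 1000) (ρ / 4) with hδdef
  have hδ : 0 < δ := by positivity
  have hδ' : δ ≤ 1 / 1000 := min_le_left _ _
  have hv : ∀ y : ℂ, ‖y‖ ≤ 3 * δ → V y ≤ 1 / 100 := fun y hy => by
    have h1 : δ ≤ ρ / 4 := min_le_right _ _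
    have h2 := hVρ y (by rw [dist_zero_right]; linarith)
    rw [hV0, Real.dist_eq, sub_zero] at h2
    exact (le_abs_self _).trans h2.le
  -- the loss in Jensen's inequality, `4 N / δ` for each of at most `ε n` stray particles, has to
  -- stay below `n / 10`
  set N := -∫ t, negLog t with hN
  have hN0 : 0 ≤ N := neg_nonneg.2 integral_negLog_nonpos
  set ε := min (1 / 1000) (δ / (40 * N + 1)) with hεdef
  have hε : 0 < ε := by positivity
  have hε' : ε ≤ 1 / 1000 := min_le_left _ _
  have hεδ : ε * (40 * N) ≤ δ := by
    have h1 : ε ≤ δ / (40 * N + 1) := min_le_right _ _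
    rw [le_div_iff₀ (by positivity)] at h1
    linarith
  refine ⟨ε, hε, hε', ?_⟩
  set C := 2 * Real.log (2 * δ) + 2 * Real.log (1 - ((1 + ε) / (1 + 2 * ε)) ^ 2) with hC
  set b := volume (Metric.closedBall (0 : ℂ) 2) with hb
  have hb' : b ≠ ⊤ := measure_closedBall_lt_top.ne
  have hbound : ∀ n : ℕ, 0 < n → gasLaw V n (sphereLikeConfigs ε n) ≤
      ENNReal.ofReal (b.toReal * (δ ^ 2 * Real.exp C)⁻¹ * (n * Real.exp (-(n / 10)))) := by
    intro n hn
    have hq : 0 < δ ^ 2 * Real.exp (n / 10 + C) := by positivity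
    have hsub : sphereLikeConfigs ε n ≤ᵐ[gasLaw V n] ⋃ i : Fin n, {z | ‖z i‖ ≤ 2 ∧
        ENNReal.ofReal (δ ^ 2 * Real.exp (n / 10 + C)) * ENNReal.ofReal (weight V n z) ≤
        ∫⁻ y in Set.Icc 0 δ ×ℂ Set.Icc δ (2 * δ),
          ENNReal.ofReal (weight V n (Function.update z i y))} := by
      have hac : gasLaw V n ≪ volume := withDensity_absolutelyContinuous _ _
      filter_upwards [hac.ae_le (ae_ne_and_ne_conj n)] with z hz hzT
      exact Set.mem_iUnion.2
        (exists_ofReal_mul_weight_le hV hn hε hε' hδ hδ' hεδ hv hz.1 hz.2 hzT)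
    refine (measure_mono_ae hsub).trans ((measure_iUnion_fintype_le _ _).trans ?_)
    refine (Finset.sum_le_sum fun i _ => gasLaw_le_of_le_lintegral_update hV i _ hq).trans ?_
    rw [Finset.sum_const, Finset.card_univ, Fintype.card_fin, nsmul_eq_mul,
      ← ENNReal.ofReal_inv_of_pos hq, ← hb]
    nth_rewrite 1 [← ENNReal.ofReal_toReal hb']
    rw [← ENNReal.ofReal_natCast, ← ENNReal.ofReal_mul (by positivity),
      ← ENNReal.ofReal_mul (by positivity)]
    refine le_of_eq (congrArg _ ?_)
    rw [Real.exp_add, Real.exp_neg]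
    field_simp
  have hlim : Tendsto (fun n : ℕ => ENNReal.ofReal
      (b.toReal * (δ ^ 2 * Real.exp C)⁻¹ * (n * Real.exp (-(n / 10))))) atTop (𝓝 0) := by
    have h1 : Tendsto (fun x : ℝ => 10 * (x ^ 1 * Real.exp (-x))) atTop (𝓝 (10 * 0)) :=
      (Real.tendsto_pow_mul_exp_neg_atTop_nhds_zero 1).const_mul 10
    have h2 : Tendsto (fun n : ℕ => (n : ℝ) / 10) atTop atTop :=
      tendsto_natCast_atTop_atTop.atTop_div_const (by norm_num)
    have h3 := ENNReal.tendsto_ofReal ((h1.comp h2).const_mul (b.toReal * (δ ^ 2 * Real.exp C)⁻¹))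
    simp only [mul_zero, ENNReal.ofReal_zero] at h3
    refine h3.congr fun n => ?_
    simp only [Function.comp_apply, pow_one]
    congr 2
    ring
  refine tendsto_of_tendsto_of_tendsto_of_le_of_le' tendsto_const_nhds hlim
    (Eventually.of_forall fun _ => zero_le) ?_
  filter_upwards [eventually_gt_atTop 0] with n hn using hbound n hn

/-! ### The uniform measure on the unit sphere of the quaternions -/

open scoped Pointwise

lemma sphereUniform_apply {s : Set ℍ[ℝ]} (hs : MeasurableSet s) :
    sphereUniform s = ((volume : Measure ℍ[ℝ]).toSphere Set.univ)⁻¹ *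
      (Module.finrank ℝ ℍ[ℝ] *
        volume (Set.Ioo (0 : ℝ) 1 • (Metric.sphere (0 : ℍ[ℝ]) 1 ∩ s))) := by
  rw [sphereUniform, Measure.map_apply measurable_subtype_coe hs, Measure.smul_apply, smul_eq_mul,
    Measure.toSphere_apply' _ (measurable_subtype_coe hs), Subtype.image_preimage_coe]

instance : IsProbabilityMeasure sphereUniform := by
  have h0 : (volume : Measure ℍ[ℝ]).toSphere Set.univ ≠ 0 :=
    Measure.measure_univ_ne_zero.2 (Measure.toSphere_ne_zero _)
  refine ⟨?_⟩
  rw [sphereUniform, Measure.map_apply measurable_subtype_coe MeasurableSet.univ, Set.preimage_univ,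
    Measure.smul_apply, smul_eq_mul, ENNReal.inv_mul_cancel h0 (measure_ne_top _ _)]

lemma ae_norm_eq_one_sphereUniform : ∀ᵐ q ∂sphereUniform, ‖q‖ = 1 := by
  rw [sphereUniform, ae_map_iff measurable_subtype_coe.aemeasurable
    (measurableSet_eq_fun measurable_norm measurable_const)]
  exact ae_of_all _ fun q => mem_sphere_zero_iff_norm.1 q.2

lemma measurePreserving_sphereUniform (T : ℍ[ℝ] ≃ₗᵢ[ℝ] ℍ[ℝ]) :
    MeasurePreserving T sphereUniform sphereUniform := by
  have hT : Measurable T := T.continuous.measurable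
  refine ⟨hT, Measure.ext fun s hs => ?_⟩
  rw [Measure.map_apply hT hs, sphereUniform_apply (hT hs), sphereUniform_apply hs]
  have hset : Set.Ioo (0 : ℝ) 1 • (Metric.sphere (0 : ℍ[ℝ]) 1 ∩ T ⁻¹' s)
      = T ⁻¹' (Set.Ioo (0 : ℝ) 1 • (Metric.sphere (0 : ℍ[ℝ]) 1 ∩ s)) := by
    ext q
    simp only [Set.mem_smul, Set.mem_inter_iff, mem_sphere_zero_iff_norm, Set.mem_preimage]
    constructor
    · rintro ⟨r, hr, p, ⟨hp, hps⟩, rfl⟩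
      exact ⟨r, hr, T p, ⟨by rwa [T.norm_map], hps⟩, (map_smul T r p).symm⟩
    · rintro ⟨r, hr, p, ⟨hp, hps⟩, h⟩
      refine ⟨r, hr, T.symm p, ⟨by rwa [T.symm.norm_map], by simpa using hps⟩, ?_⟩
      rw [← map_smul, h, T.symm_apply_apply]
  rw [hset, (T.measurePreserving).measure_preimage_emb T.toHomeomorph.measurableEmbedding]

lemma integral_re_mul_sq_sphereUniform {a : ℍ[ℝ]} (ha : ‖a‖ = 1) :
    ∫ q, (a * q).re ^ 2 ∂sphereUniform = ∫ q, q.re ^ 2 ∂sphereUniform := by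
  let T : ℍ[ℝ] ≃ₗᵢ[ℝ] ℍ[ℝ] := LinearIsometry.toLinearIsometryEquiv
    ({ toLinearMap := LinearMap.mulLeft ℝ a
       norm_map' := fun q => by simp [ha] } : ℍ[ℝ] →ₗᵢ[ℝ] ℍ[ℝ]) rfl
  exact (measurePreserving_sphereUniform T).integral_comp T.toHomeomorph.measurableEmbedding
    fun q => q.re ^ 2

/-- Left multiplication by the quaternion units permutes the four coordinates up to sign, so
their squares have equal means, which add up to `1`. -/
lemma integral_re_sq_sphereUniform : ∫ q, q.re ^ 2 ∂sphereUniform = 1 / 4 := by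
  have hnorm : ∀ q : ℍ[ℝ], ‖q‖ ^ 2 = q.re ^ 2 + q.imI ^ 2 + q.imJ ^ 2 + q.imK ^ 2 := fun q => by
    rw [sq, ← Quaternion.normSq_eq_norm_mul_self, Quaternion.normSq_def']
  have hunit : ∀ q : ℍ[ℝ], ‖q‖ ^ 2 = 1 → ‖q‖ = 1 := fun q hq => by
    have := norm_nonneg q
    nlinarith
  have hrot : ∀ b c d : ℝ, b ^ 2 + c ^ 2 + d ^ 2 = 1 →
      ∫ q : ℍ[ℝ], (b * q.imI + c * q.imJ + d * q.imK) ^ 2 ∂sphereUniform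
        = ∫ q, q.re ^ 2 ∂sphereUniform := by
    intro b c d hbcd
    obtain ⟨a, h0, h1, h2, h3⟩ : ∃ a : ℍ[ℝ], a.re = 0 ∧ a.imI = b ∧ a.imJ = c ∧ a.imK = d :=
      ⟨⟨0, b, c, d⟩, rfl, rfl, rfl, rfl⟩
    rw [← integral_re_mul_sq_sphereUniform (a := a)
      (hunit _ (by rw [hnorm, h0, h1, h2, h3]; linarith))]
    refine integral_congr_ae (ae_of_all _ fun q => ?_)
    simp only [Quaternion.re_mul, h0, h1, h2, h3]
    ring
  have hI := hrot 1 0 0 (by norm_num)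
  have hJ := hrot 0 1 0 (by norm_num)
  have hK := hrot 0 0 1 (by norm_num)
  simp only [zero_mul, one_mul, add_zero, zero_add] at hI hJ hK
  have hint : ∀ f : ℍ[ℝ] → ℝ, Continuous f → (∀ q, f q ^ 2 ≤ ‖q‖ ^ 2) →
      Integrable (fun q => f q ^ 2) sphereUniform := by
    intro f hf hle
    refine Integrable.of_bound (hf.pow 2).aestronglyMeasurable 1 ?_
    filter_upwards [ae_norm_eq_one_sphereUniform] with q hq
    have := hle q
    rw [hq] at this
    rw [Real.norm_of_nonneg (sq_nonneg _)]
    linarith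
  have h0 := hint (fun q => q.re) Quaternion.continuous_re fun q => by rw [hnorm]; nlinarith
  have h1 := hint (fun q => q.imI) Quaternion.continuous_imI fun q => by rw [hnorm]; nlinarith
  have h2 := hint (fun q => q.imJ) Quaternion.continuous_imJ fun q => by rw [hnorm]; nlinarith
  have h3 := hint (fun q => q.imK) Quaternion.continuous_imK fun q => by rw [hnorm]; nlinarith
  have hsum : ∫ q : ℍ[ℝ], (q.re ^ 2 + q.imI ^ 2 + q.imJ ^ 2 + q.imK ^ 2) ∂sphereUniform = 1 := by
    rw [integral_congr_ae (g := fun _ => (1 : ℝ))]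
    · simp
    · filter_upwards [ae_norm_eq_one_sphereUniform] with q hq
      rw [← hnorm, hq, one_pow]
  have h01 : Integrable (fun q : ℍ[ℝ] => q.re ^ 2 + q.imI ^ 2) sphereUniform := h0.add h1
  have h012 : Integrable (fun q : ℍ[ℝ] => q.re ^ 2 + q.imI ^ 2 + q.imJ ^ 2) sphereUniform :=
    h01.add h2
  rw [integral_add h012 h3, integral_add h01 h2, integral_add h0 h1] at hsum
  linarith

/-- A bounded continuous function on `ℍ` measuring the distance to the unit sphere. -/
noncomputable def sphereDistTest : ℍ[ℝ] →ᵇ ℝ :=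
  BoundedContinuousFunction.ofNormedAddCommGroup (fun q => min 1 |‖q‖ - 1|) (by fun_prop) 1
    fun q => by
      rw [Real.norm_of_nonneg (le_min zero_le_one (abs_nonneg _))]
      exact min_le_left _ _

lemma two_mul_re_sq_sub_le (q : ℍ[ℝ]) : |2 * q.re ^ 2 - ‖q‖ ^ 2| ≤ max 1 (‖q‖ ^ 2) := by
  have h : q.re ^ 2 ≤ ‖q‖ ^ 2 := by
    rw [sq ‖q‖, ← Quaternion.normSq_eq_norm_mul_self, Quaternion.normSq_def']
    nlinarith [sq_nonneg q.imI, sq_nonneg q.imJ, sq_nonneg q.imK]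
  refine le_max_of_le_right (abs_le.2 ⟨?_, ?_⟩) <;> nlinarith [sq_nonneg q.re]

/-- A bounded continuous function on `ℍ` equal to `Re q²` on the unit ball. -/
noncomputable def reSqTest : ℍ[ℝ] →ᵇ ℝ :=
  BoundedContinuousFunction.ofNormedAddCommGroup
    (fun q => (2 * q.re ^ 2 - ‖q‖ ^ 2) / max 1 (‖q‖ ^ 2))
    (by
      have := Quaternion.continuous_re
      exact Continuous.div (by fun_prop) (by fun_prop) fun q => by positivity) 1
    fun q => by
      rw [Real.norm_eq_abs, abs_div, abs_of_pos (a := max 1 (‖q‖ ^ 2)) (by positivity)]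
      exact (div_le_one (by positivity)).2 (two_mul_re_sq_sub_le q)

lemma sphereDistTest_apply (q : ℍ[ℝ]) : sphereDistTest q = min 1 |‖q‖ - 1| := rfl

lemma reSqTest_apply (q : ℍ[ℝ]) :
    reSqTest q = (2 * q.re ^ 2 - ‖q‖ ^ 2) / max 1 (‖q‖ ^ 2) := rfl

lemma integral_sphereDistTest : ∫ q, sphereDistTest q ∂sphereUniform = 0 := by
  refine integral_eq_zero_of_ae ?_
  filter_upwards [ae_norm_eq_one_sphereUniform] with q hq
  simp [sphereDistTest_apply, hq]

lemma integral_reSqTest : ∫ q, reSqTest q ∂sphereUniform = -(1 / 2) := by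
  have h : ∫ q, reSqTest q ∂sphereUniform = ∫ q : ℍ[ℝ], (2 * q.re ^ 2 - 1) ∂sphereUniform := by
    refine integral_congr_ae ?_
    filter_upwards [ae_norm_eq_one_sphereUniform] with q hq
    simp [reSqTest_apply, hq]
  have hi : Integrable (fun q : ℍ[ℝ] => q.re ^ 2) sphereUniform :=
    not_imp_comm.1 integral_undef (by rw [integral_re_sq_sphereUniform]; norm_num)
  rw [h, integral_sub (hi.const_mul 2) (integrable_const _), integral_const_mul,
    integral_re_sq_sphereUniform]
  norm_num

/-! ### Test functions seen by the conjugated empirical measure -/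

lemma re_conj_by_unit {u : ℍ[ℝ]} (hu : ‖u‖ = 1) (q : ℍ[ℝ]) : (u * q * star u).re = q.re := by
  have h1 : ∀ a b : ℍ[ℝ], (a * b).re = (b * a).re := fun a b => by
    rw [Quaternion.re_mul, Quaternion.re_mul]
    ring
  rw [h1, ← mul_assoc, Quaternion.star_mul_self, Quaternion.normSq_eq_norm_mul_self, hu, one_mul,
    Quaternion.coe_one, one_mul]

lemma norm_conj_by_unit {u : ℍ[ℝ]} (hu : ‖u‖ = 1) (q : ℍ[ℝ]) : ‖u * q * star u‖ = ‖q‖ := by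
  rw [norm_mul, norm_mul, Quaternion.norm_star, hu, one_mul, mul_one]

lemma norm_coeComplex (x : ℂ) : ‖Quaternion.coeComplex x‖ = ‖x‖ := by
  have h : ‖Quaternion.coeComplex x‖ ^ 2 = ‖x‖ ^ 2 := by
    rw [sq, ← Quaternion.normSq_eq_norm_mul_self, Quaternion.normSq_def', Complex.sq_norm,
      Complex.normSq_apply]
    simp
    ring
  exact (pow_left_inj₀ (norm_nonneg _) (norm_nonneg _) two_ne_zero).1 h

/-- Test functions depending on the real part and the norm only do not see the random
conjugations. -/
lemma integral_conjugatedEmpirical {n : ℕ} (z : Fin n → ℂ) (u : ℕ → ℍ[ℝ]) (f : ℍ[ℝ] →ᵇ ℝ)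
    (F : ℂ → ℝ) (hf : ∀ i x, f (u i * Quaternion.coeComplex x * star (u i)) = F x)
    (hF : ∀ x, F (conj x) = F x) :
    ∫ q, f q ∂(conjugatedEmpirical n z u) = (∑ i, F (z i)) / n := by
  rw [conjugatedEmpirical, integral_smul_measure,
    integral_finsetSum_measure fun i _ => f.integrable _]
  simp only [integral_dirac, hf, Fin.sum_univ_add, withConj, Fin.append_left, Fin.append_right, hF,
    ENNReal.toReal_inv, ENNReal.toReal_natCast, smul_eq_mul]
  push_cast
  rcases eq_or_ne (n : ℝ) 0 with hn | hn
  · simp [hn]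
  · field_simp
    ring

/-- Closeness of the empirical measure to the uniform measure on the sphere, as measured by two
test functions whose means there are `0` and `-1/2`, forces a sphere-like configuration. -/
lemma mem_sphereLikeConfigs_of_integral_lt {n : ℕ} (hn : 0 < n) {ε : ℝ} (hε : 0 < ε)
    (hε' : ε ≤ 1 / 1000) (z : Fin n → ℂ) {u : ℕ → ℍ[ℝ]} (hu : ∀ i, ‖u i‖ = 1)
    (h1 : ∫ q, sphereDistTest q ∂(conjugatedEmpirical n z u) < ε ^ 2)
    (h2 : ∫ q, reSqTest q ∂(conjugatedEmpirical n z u) < -(49 / 100)) :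
    z ∈ sphereLikeConfigs ε n := by
  have hn' : (0 : ℝ) < n := by exact_mod_cast hn
  set F : ℂ → ℝ := fun x => min 1 |‖x‖ - 1| with hF
  set G : ℂ → ℝ := fun x => (x ^ 2).re / max 1 (‖x‖ ^ 2) with hG
  rw [integral_conjugatedEmpirical z u _ F
    (fun i x => by rw [sphereDistTest_apply, norm_conj_by_unit (hu i), norm_coeComplex])
    (fun x => by simp [hF]), div_lt_iff₀ hn'] at h1
  have hGx : ∀ i x, reSqTest (u i * Quaternion.coeComplex x * star (u i)) = G x := by
    intro i x
    rw [reSqTest_apply, norm_conj_by_unit (hu i), re_conj_by_unit (hu i), norm_coeComplex, hG,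
      Quaternion.re_coeComplex]
    congr 1
    rw [Complex.sq_norm, Complex.normSq_apply, sq x, Complex.mul_re]
    ring
  rw [integral_conjugatedEmpirical z u _ G hGx
    (fun x => by simp [hG, ← map_pow]), div_lt_iff₀ hn'] at h2
  set s : Finset (Fin n) := Finset.univ.filter fun j => |‖z j‖ - 1| ≤ ε with hs
  have hGabs : ∀ x, |G x| ≤ 1 := fun x => by
    have hre : |(x ^ 2).re| ≤ ‖x‖ ^ 2 := (Complex.abs_re_le_norm _).trans_eq (norm_pow x 2)
    simp only [hG]
    rw [abs_div, abs_of_pos (a := max 1 (‖x‖ ^ 2)) (by positivity)]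
    exact (div_le_one (by positivity)).2 (hre.trans (le_max_right _ _))
  have hbad : (sᶜ.card : ℝ) ≤ ε * n := by
    have h3 : ∑ j ∈ sᶜ, ε ≤ ∑ j ∈ sᶜ, F (z j) := by
      refine Finset.sum_le_sum fun j hj => le_min (by linarith) ?_
      rw [hs, Finset.mem_compl, Finset.mem_filter, not_and, not_le] at hj
      exact (hj (Finset.mem_univ j)).le
    have h4 : ∑ j ∈ sᶜ, F (z j) ≤ ∑ j, F (z j) :=
      Finset.sum_le_univ_sum_of_nonneg fun j => le_min zero_le_one (abs_nonneg _)
    rw [Finset.sum_const, nsmul_eq_mul] at h3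
    have h5 : (sᶜ.card : ℝ) * ε ≤ (ε * n) * ε := by nlinarith
    exact le_of_mul_le_mul_right h5 hε
  refine ⟨hbad, ?_⟩
  rw [← hs]
  have hgood : ∑ j ∈ s, (z j ^ 2).re ≤ ∑ j ∈ s, G (z j) + 3 * ε * n := by
    have h3 : ∑ j ∈ s, (z j ^ 2).re ≤ ∑ j ∈ s, (G (z j) + 3 * ε) := by
      refine Finset.sum_le_sum fun j hj => ?_
      have hj' := (abs_le.1 (Finset.mem_filter.1 hj).2).2
      set m := max 1 (‖z j‖ ^ 2) with hm
      have hm1 : 1 ≤ m := le_max_left _ _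
      have hm2 : m ≤ 1 + 3 * ε := max_le (by linarith) (by nlinarith [norm_nonneg (z j)])
      have hGm : (z j ^ 2).re = G (z j) * m := by
        simp only [hG, ← hm]
        rw [div_mul_cancel₀ _ (by positivity)]
      have := (abs_le.1 (hGabs (z j))).2
      rw [hGm]
      nlinarith
    have h4 : (s.card : ℝ) ≤ n := by
      exact_mod_cast (Finset.card_le_univ _).trans_eq (Fintype.card_fin n)
    rw [Finset.sum_add_distrib, Finset.sum_const, nsmul_eq_mul] at h3
    nlinarith
  have hrest : -(sᶜ.card : ℝ) ≤ ∑ j ∈ sᶜ, G (z j) := by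
    have h3 : ∑ j ∈ sᶜ, (-1 : ℝ) ≤ ∑ j ∈ sᶜ, G (z j) :=
      Finset.sum_le_sum fun j _ => (abs_le.1 (hGabs (z j))).1
    rw [Finset.sum_const, nsmul_eq_mul] at h3
    linarith
  have htot := Finset.sum_add_sum_compl s fun j => G (z j)
  nlinarith

end QuatGas


theorem mainTheorem4 (V : ℂ → ℝ) (hV : QuatGas.IsPotential V) (hquad : QuatGas.IsQuadratic V)
    {Ω : Type*} [MeasurableSpace Ω] (P : Measure Ω) [IsProbabilityMeasure P]
    (z : (n : ℕ) → Ω → Fin n → ℂ) (u : ℕ → Ω → ℍ[ℝ])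
    (hz : ∀ n, HasLaw (z n) (QuatGas.gasLaw V n) P)
    (hu : ∀ i, HasLaw (u i) QuatGas.sphereUniform P)
    (hu_indep : iIndepFun u P)
    (hzu_indep : ∀ n, IndepFun (z n) (fun ω i => u i ω) P) :
    ¬ QuatGas.ConvergesAlmostSurely P
        (fun n ω => QuatGas.conjugatedEmpirical n (z n ω) (fun i => u i ω))
        QuatGas.sphereUniform ∧
    ¬ QuatGas.ConvergesInProbability P
        (fun n ω => QuatGas.conjugatedEmpirical n (z n ω) (fun i => u i ω))
        QuatGas.sphereUniform := by
  have hV0 : V 0 = 0 := by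
    obtain ⟨a₁, a₂, a₃, h⟩ := hquad
    simpa using h 0
  obtain ⟨ε, hε, hε', hlim⟩ := QuatGas.exists_tendsto_gasLaw_sphereLikeConfigs hV hV0
  set T : ℕ → Set Ω := fun n => z n ⁻¹' QuatGas.sphereLikeConfigs ε n with hT
  have hPT : Tendsto (fun n => P (T n)) atTop (𝓝 0) :=
    tendsto_of_tendsto_of_tendsto_of_le_of_le tendsto_const_nhds hlim (fun _ => zero_le) fun n => by
      refine (Measure.le_map_apply (hz n).aemeasurable _).trans_eq ?_
      rw [(hz n).map_eq]
  have hunit : ∀ᵐ ω ∂P, ∀ i, ‖u i ω‖ = 1 := ae_all_iff.2 fun i => by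
    have h := QuatGas.ae_norm_eq_one_sphereUniform
    rw [← (hu i).map_eq] at h
    exact ae_of_ae_map (hu i).aemeasurable h
  set m : ℕ → Ω → Measure ℍ[ℝ] :=
    fun n ω => QuatGas.conjugatedEmpirical n (z n ω) (fun i => u i ω) with hm
  constructor
  · intro hconv
    -- almost surely all configurations from some index on are sphere-like; for each fixed index
    -- this event is null
    have hnull : P (⋃ N, ⋂ n ≥ N, T n) = 0 := by
      refine measure_iUnion_null fun N => le_antisymm (ge_of_tendsto hPT ?_) zero_le
      filter_upwards [eventually_ge_atTop N] with n hn
      exact measure_mono (Set.biInter_subset_of_mem hn)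
    have hall : ∀ᵐ ω ∂P, ω ∈ ⋃ N, ⋂ n ≥ N, T n := by
      filter_upwards [hconv, hunit] with ω hω hωu
      have h1 := (hω QuatGas.sphereDistTest).eventually_lt_const
        (show _ < ε ^ 2 by rw [QuatGas.integral_sphereDistTest]; positivity)
      have h2 := (hω QuatGas.reSqTest).eventually_lt_const
        (show _ < -(49 / 100 : ℝ) by rw [QuatGas.integral_reSqTest]; norm_num)
      obtain ⟨N, hN⟩ := eventually_atTop.1 ((h1.and h2).and (eventually_gt_atTop 0))
      simp only [Set.mem_iUnion, Set.mem_iInter]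
      exact ⟨N, fun n hn => QuatGas.mem_sphereLikeConfigs_of_integral_lt (hN n hn).2 hε hε' _ hωu
        (hN n hn).1.1 (hN n hn).1.2⟩
    obtain ⟨ω, hω, hω'⟩ := (hall.and (measure_eq_zero_iff_ae_notMem.1 hnull)).exists
    exact hω' hω
  · intro hconv
    have h1 := tendstoInMeasure_iff_dist.1 (hconv QuatGas.sphereDistTest) (ε ^ 2) (by positivity)
    have h2 := tendstoInMeasure_iff_dist.1 (hconv QuatGas.reSqTest) (1 / 100) (by norm_num)
    have hsum := (h1.add h2).add hPT
    simp only [add_zero] at hsum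
    refine absurd (ge_of_tendsto hsum ?_) (not_le.2 one_pos)
    filter_upwards [eventually_gt_atTop 0] with n hn
    rw [← measure_univ (μ := P)]
    refine le_trans ?_ ((measure_union_le _ _).trans (add_le_add_left (measure_union_le _ _) _))
    refine measure_mono_ae ?_
    filter_upwards [hunit] with ω hω _
    by_contra hcon
    change ¬ ((_ ∨ _) ∨ _) at hcon
    rw [not_or, not_or] at hcon
    obtain ⟨⟨hc1, hc2⟩, hc3⟩ := hcon
    refine hc3 (QuatGas.mem_sphereLikeConfigs_of_integral_lt hn hε hε' _ hω ?_ ?_)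
    · rw [Set.mem_ofPred_eq, not_le, QuatGas.integral_sphereDistTest, Real.dist_eq, sub_zero] at hc1
      exact (le_abs_self _).trans_lt hc1
    · rw [Set.mem_ofPred_eq, not_le, QuatGas.integral_reSqTest, Real.dist_eq] at hc2
      linarith [(abs_lt.1 hc2).2]
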